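/- Let $t\ge 2$ be an integer, let $\psi:\mathbb{N}\to(0,\infty)$ be a function on the positive integers, and let $$W_t(\psi):=\Big\{x\in[0,1]:\ \Big|x-\frac{p}{t^n}\Big|<\psi(n)\ \text{for infinitely many } (p,n)\in\mathbb{Z}\times\mathbb{N}\Big\}.$$ Then for every non-empty set $A\subseteq[0,1]$, $$\dim_{\rm H}\big(W_t(\psi)\cap A\big)\ \le\ \dim_{\rm H}W_t(\psi)\cdot\dim_{\rm P}A .$$ Here $\dim_{\rm H}$ is the Hausdorff dimension and $\dim_{\rm P}$ is the packing dimension: for $F\subseteq\mathbb{R}$, $s\ge 0$ and $\delta>0$ let $\mathcal{P}^s_\delta(F)$ be the supremum of $\sum_i(\operatorname{diam}B_i)^s$ over all families $\{B_i\}$ of pairwise disjoint balls of radius at most $\delta$ with centres in $F$, let $\mathcal{P}^s_0(F)=\lim_{\delta\to0}\mathcal{P}^s_\delta(F)$, let $\mathcal{P}^s(F)=\inf\big\{\sum_i\mathcal{P}^s_0(F_i): F\subseteq\bigcup_iF_i\big\}$ over countable covers, and $\dim_{\rm P}F=\inf\{s\ge 0:\mathcal{P}^s(F)=0\}$. -/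

import Mathlib

namespace WellApprox

open Set Metric
open scoped ENNReal NNReal

/-- The set `W_t(ψ)` of the `x ∈ [0,1]` such that `|x - p / t ^ n| < ψ n` for infinitely many pairs
`(p, n)` with `p` an integer and `n` a positive integer. -/
def wellApprox (t : ℕ) (ψ : ℕ → ℝ) : Set ℝ :=
  {x | x ∈ Icc (0 : ℝ) 1 ∧
    {q : ℤ × ℕ | 1 ≤ q.2 ∧ |x - (q.1 : ℝ) / (t : ℝ) ^ q.2| < ψ q.2}.Infinite}

/-- A `δ`-packing of `F ⊆ ℝ`: a family of pairwise disjoint (closed) balls of radius at most `δ`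
with centres in `F`. A ball is given by the pair of its centre and its (positive) radius. -/
def IsPacking (δ : ℝ) (F : Set ℝ) (S : Set (ℝ × ℝ)) : Prop :=
  (∀ B ∈ S, B.1 ∈ F ∧ 0 < B.2 ∧ B.2 ≤ δ) ∧
    S.PairwiseDisjoint (fun B => closedBall B.1 B.2)

/-- `P_δ^s(F)`: the supremum of `∑ (diam B_i) ^ s` over the `δ`-packings `{B_i}` of `F`. -/
noncomputable def packingPreDelta (s : ℝ≥0) (δ : ℝ) (F : Set ℝ) : ℝ≥0∞ :=
  ⨆ (S : Set (ℝ × ℝ)) (_ : IsPacking δ F S),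
    ∑' B : S, ediam (closedBall B.1.1 B.1.2) ^ (s : ℝ)

/-- `P_0^s(F)`: the limit of `P_δ^s(F)` as `δ → 0`. As `P_δ^s(F)` is monotone in `δ`, it is the
infimum over `δ > 0`. -/
noncomputable def packingPre (s : ℝ≥0) (F : Set ℝ) : ℝ≥0∞ :=
  ⨅ (δ : ℝ) (_ : 0 < δ), packingPreDelta s δ F

/-- The `s`-dimensional packing measure of `F`: the infimum of `∑ P_0^s(F_i)` over the countable
covers `{F_i}` of `F`. -/
noncomputable def packingMeasure (s : ℝ≥0) (F : Set ℝ) : ℝ≥0∞ :=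
  ⨅ (U : ℕ → Set ℝ) (_ : F ⊆ ⋃ i, U i), ∑' i, packingPre s (U i)

/-- The packing dimension of `F`: the infimum of the `s ≥ 0` with `P^s(F) = 0`. -/
noncomputable def dimP (F : Set ℝ) : ℝ≥0∞ :=
  ⨅ (s : ℝ≥0) (_ : packingMeasure s F = 0), (s : ℝ≥0∞)

end WellApprox

namespace WellApprox

open Set Metric Filter Topology MeasureTheory
open scoped ENNReal NNReal

/-! Let `d` be the Hausdorff dimension of `W_t(ψ)`. Everything rests on comparing `ψ n` with `t ^
(-n τ)` for `τ ≥ 1`. If `ψ n ≥ t ^ (-n τ)` infinitely often, then `d ≥ 1 / τ`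
(`ofReal_inv_le_dimH_wellApprox`): numbers whose base `t` digits vanish on sparse blocks, from `a k`
to about `τ * a k`, lie in `W_t(ψ)`, and the remaining free digits carry enough dimension
(`le_dimH_image_spread`). So if `d < q < 1` and `τ = 1 / q`, then `ψ n < t ^ (-n τ)` for all large
`n`. In that case the intervals of radius `t ^ (-n τ)` about grid points near `A` cover `W_t(ψ) ∩
A`. If `A` has zero `s`-dimensional packing measure, it splits into countably many pieces, each with
`O(t ^ (n s))` nearby grid points (`tsum_near_grid_le`). Summing gives dimension at most `s / τ`,
hence the bound `q * dimP A` (`dimH_inter_le_dimP_div`). Now let `q` decrease to `d`. For `d ≥ 1`,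
`dimH_le_dimP` is enough. -/

/-! ### Upper bound: grid covers counted by packings. -/

/-- The number of points of the grid `t⁻ⁿ ℤ` lying close to `F` is controlled by the packings
of `F`. -/
lemma tsum_near_grid_le {b : ℝ} (hb : 0 < b) {s : ℝ≥0} {δ : ℝ} {F : Set ℝ} (n : ℕ)
    (hn : (b ^ n)⁻¹ ≤ δ) :
    ∑' _ : {p : ℤ | ∃ x ∈ F, |x - p / b ^ n| ≤ (b ^ n)⁻¹}, ENNReal.ofReal (b ^ n)⁻¹ ^ (s : ℝ) ≤
      4 * packingPreDelta s δ F := by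
  set r : ℝ := (b ^ n)⁻¹ with hr
  have hr0 : 0 < r := by positivity
  set P : Set ℤ := {p : ℤ | ∃ x ∈ F, |x - p / b ^ n| ≤ r} with hP
  -- Within one residue class mod 4, grid points are `4 * r` apart, so points of `F` within `r` of
  -- them stay `2 * r` apart.
  have hres : ∀ a : Fin 4, ∑' _ : {p : ℤ | p ∈ P ∧ p % 4 = (a : ℕ)},
      ENNReal.ofReal r ^ (s : ℝ) ≤ packingPreDelta s δ F := by
    intro a
    have hx : ∀ p : {p : ℤ | p ∈ P ∧ p % 4 = (a : ℕ)}, ∃ x ∈ F, |x - (p : ℤ) * r| ≤ r := by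
      rintro ⟨p, ⟨x, hxF, hxp⟩, -⟩
      exact ⟨x, hxF, by simpa [hr, div_eq_mul_inv] using hxp⟩
    choose x hxF hxr using hx
    have hsep : ∀ p q, p ≠ q → 2 * r ≤ |x p - x q| := by
      intro p q hpq
      have h1 : (4 : ℤ) ≤ |(p : ℤ) - q| := by
        have hp := p.2.2
        have hq := q.2.2
        have : (p : ℤ) ≠ q := fun h => hpq (Subtype.ext h)
        rcases abs_cases ((p : ℤ) - q) with h | h <;> omega
      have h2 : (4 : ℝ) ≤ |((p : ℤ) : ℝ) - (q : ℤ)| := by exact_mod_cast h1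
      have h3 : |((p : ℤ) : ℝ) * r - (q : ℤ) * r| = |((p : ℤ) : ℝ) - (q : ℤ)| * r := by
        rw [← sub_mul, abs_mul, abs_of_pos hr0]
      have h4 : 4 * r ≤ |((p : ℤ) : ℝ) * r - (q : ℤ) * r| := by
        rw [h3]; gcongr
      have hp := abs_le.1 (hxr p)
      have hq := abs_le.1 (hxr q)
      rcases le_abs.1 h4 with h | h
      · exact le_abs.2 (Or.inl (by linarith))
      · exact le_abs.2 (Or.inr (by linarith))
    -- Radius `r / 2` makes the diameter exactly `r`.
    let f : {p : ℤ | p ∈ P ∧ p % 4 = (a : ℕ)} → ℝ × ℝ := fun p => (x p, r / 2)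
    have hf : Function.Injective f := by
      intro p q h
      by_contra hpq
      have h1 := hsep p q hpq
      have h2 : x p = x q := congrArg Prod.fst h
      rw [h2] at h1
      simp at h1
      linarith
    have hpack : IsPacking δ F (range f) := by
      refine ⟨?_, ?_⟩
      · rintro _ ⟨p, rfl⟩
        exact ⟨hxF p, by simp only [f]; linarith, by simp only [f]; linarith⟩
      · rintro _ ⟨p, rfl⟩ _ ⟨q, rfl⟩ hpq
        refine closedBall_disjoint_closedBall ?_
        have h1 := hsep p q (fun h => hpq (by rw [h]))
        simp only [f, Real.dist_eq]
        linarith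
    calc ∑' _ : {p : ℤ | p ∈ P ∧ p % 4 = (a : ℕ)}, ENNReal.ofReal r ^ (s : ℝ)
        = ∑' p, ediam (closedBall (f p).1 (f p).2) ^ (s : ℝ) := by
          refine tsum_congr fun p => ?_
          rw [Real.closedBall_eq_Icc, Real.ediam_Icc]
          congr 2
          simp only [f]; ring
      _ = ∑' B : range f, ediam (closedBall B.1.1 B.1.2) ^ (s : ℝ) :=
          (tsum_range (fun B : ℝ × ℝ => ediam (closedBall B.1 B.2) ^ (s : ℝ)) hf).symm
      _ ≤ _ := by
          unfold packingPreDelta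
          exact le_iSup₂_of_le (range f) hpack le_rfl
  have hU : P = ⋃ a : Fin 4, {p : ℤ | p ∈ P ∧ p % 4 = (a : ℕ)} := by
    ext p
    simp only [mem_iUnion, mem_ofPred_eq]
    constructor
    · intro h
      exact ⟨⟨(p % 4).toNat, by omega⟩, h, by simp only; omega⟩
    · rintro ⟨a, h, -⟩
      exact h
  rw [hU]
  refine (ENNReal.tsum_iUnion_le (fun _ => ENNReal.ofReal r ^ (s : ℝ)) _).trans ?_
  refine (Finset.sum_le_sum fun a _ => hres a).trans ?_
  simp

lemma inv_pow_rpow {b : ℝ} (hb : 0 < b) (n : ℕ) (α : ℝ) : ((b ^ n)⁻¹) ^ α = (b⁻¹ ^ α) ^ n := by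
  rw [← inv_pow, ← Real.rpow_natCast, ← Real.rpow_natCast, ← Real.rpow_mul (by positivity),
    ← Real.rpow_mul (by positivity), mul_comm]

/-- A set of finite `packingPreDelta s δ`, all of whose points are close to points of `t⁻ⁿ ℤ` for
infinitely many `n`, has Hausdorff dimension at most `s / τ`. -/
lemma dimH_le_of_packingPreDelta {b : ℝ} (hb : 1 < b) {s : ℝ≥0} {δ τ : ℝ} (hδ : 0 < δ)
    (hτ : 1 ≤ τ) {F : Set ℝ} (hF : packingPreDelta s δ F ≠ ∞)
    (h : ∀ x ∈ F, ∃ᶠ n : ℕ in atTop, ∃ p : ℤ, |x - p / b ^ n| ≤ (b ^ n)⁻¹ ^ τ) :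
    dimH F ≤ ENNReal.ofReal (s / τ) := by
  have hb0 : 0 < b := by linarith
  refine dimH_le fun d hd => ?_
  by_contra! hlt
  have hds : (s : ℝ) < τ * d := by
    rw [← ENNReal.ofReal_coe_nnreal, ENNReal.ofReal_lt_ofReal_iff_of_nonneg (by positivity),
      div_lt_iff₀ (by linarith)] at hlt
    linarith
  have hd0 : (0 : ℝ) < d := by
    have : (0 : ℝ) ≤ s := s.2
    nlinarith
  -- The surplus exponent: the level `n` sum is at most a constant times `b ^ (-n α)`, which is
  -- summable.
  set α : ℝ := τ * d - s with hα
  have hα0 : 0 < α := by linarith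
  set θ : ℝ := b⁻¹ ^ α with hθ
  have hb1 : b⁻¹ < 1 := inv_lt_one_of_one_lt₀ hb
  have hθ1 : θ < 1 := Real.rpow_lt_one (by positivity) hb1 hα0
  have hθ0 : 0 ≤ θ := by positivity
  have hrn : ∀ n : ℕ, (b ^ n)⁻¹ ≤ 1 := fun n => inv_le_one_of_one_le₀ (one_le_pow₀ hb.le)
  have hρ : Tendsto (fun n : ℕ => (b ^ n)⁻¹) atTop (𝓝 0) := by
    simpa only [inv_pow] using tendsto_pow_atTop_nhds_zero_of_lt_one (by positivity) hb1
  have hle : ∀ n : ℕ, (b ^ n)⁻¹ ^ τ ≤ (b ^ n)⁻¹ := fun n => by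
    conv_rhs => rw [← Real.rpow_one (b ^ n)⁻¹]
    exact Real.rpow_le_rpow_of_exponent_ge (by positivity) (hrn n) hτ
  set C : ℝ≥0∞ := 4 * packingPreDelta s δ F with hC
  have hCtop : C ≠ ∞ := ENNReal.mul_ne_top (by simp) hF
  let T : ℕ → ℤ → Set ℝ := fun n p => F ∩ closedBall (p / b ^ n) ((b ^ n)⁻¹ ^ τ)
  have hT : ∀ n p, ediam (T n p) ≤ ENNReal.ofReal (2 * (b ^ n)⁻¹ ^ τ) := by
    intro n p
    refine (ediam_mono inter_subset_right).trans ?_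
    rw [Real.closedBall_eq_Icc, Real.ediam_Icc]
    exact ENNReal.ofReal_le_ofReal (by linarith)
  have hsum : ∀ᶠ n in atTop, ∑' p, ediam (T n p) ^ (d : ℝ) ≤
      ENNReal.ofReal (2 ^ (d : ℝ)) * C * ENNReal.ofReal θ ^ n := by
    filter_upwards [hρ.eventually_le_const hδ] with n hn
    have key : ∀ p, ediam (T n p) ^ (d : ℝ) ≤ {p : ℤ | ∃ x ∈ F, |x - p / b ^ n| ≤ (b ^ n)⁻¹}.indicator
        (fun _ => ENNReal.ofReal (2 ^ (d : ℝ)) * ENNReal.ofReal θ ^ n *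
          ENNReal.ofReal (b ^ n)⁻¹ ^ (s : ℝ)) p := by
      intro p
      by_cases hp : p ∈ {p : ℤ | ∃ x ∈ F, |x - p / b ^ n| ≤ (b ^ n)⁻¹}
      · rw [indicator_of_mem hp]
        refine (ENNReal.rpow_le_rpow (hT n p) hd0.le).trans (le_of_eq ?_)
        rw [ENNReal.ofReal_rpow_of_nonneg (by positivity) hd0.le,
          ENNReal.ofReal_rpow_of_nonneg (by positivity) s.coe_nonneg, ← ENNReal.ofReal_pow hθ0,
          ← ENNReal.ofReal_mul (by positivity), ← ENNReal.ofReal_mul (by positivity),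
          Real.mul_rpow (by positivity) (by positivity), ← Real.rpow_mul (by positivity),
          hθ, ← inv_pow_rpow hb0, mul_assoc, ← Real.rpow_add (by positivity)]
        congr 3
        rw [hα]; ring
      · have : T n p = ∅ := by
          refine eq_empty_of_forall_notMem fun x hx => hp ⟨x, hx.1, ?_⟩
          have := hx.2
          rw [mem_closedBall, Real.dist_eq] at this
          exact this.trans (hle n)
        rw [indicator_of_notMem hp, this, ediam_empty, ENNReal.zero_rpow_of_pos hd0]
    refine (ENNReal.tsum_le_tsum key).trans ?_
    rw [← tsum_subtype, ENNReal.tsum_mul_left]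
    refine (mul_le_mul_right (tsum_near_grid_le hb0 n hn) _).trans (le_of_eq ?_)
    rw [hC]; ring
  have hgeom : ∑' n : ℕ, ENNReal.ofReal (2 ^ (d : ℝ)) * C * ENNReal.ofReal θ ^ n ≠ ∞ := by
    rw [ENNReal.tsum_mul_left, ENNReal.tsum_geometric]
    refine ENNReal.mul_ne_top (ENNReal.mul_ne_top ENNReal.ofReal_ne_top hCtop) ?_
    rw [Ne, ENNReal.inv_eq_top, tsub_eq_zero_iff_le, not_le, ENNReal.ofReal_lt_one]
    exact hθ1
  have htail := ENNReal.tendsto_sum_nat_add _ hgeom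
  -- The cover at stage `N` uses all levels `n ≥ N`, indexed by `n - N`; its cost is bounded by a
  -- tail of the geometric series.
  have hcov := Measure.hausdorffMeasure_le_liminf_tsum (X := ℝ) (β := ℕ) (ι := fun _ => ℕ × ℤ)
    (d : ℝ) F (l := atTop)
    (fun N => ENNReal.ofReal (2 * (b ^ N)⁻¹)) (by
      have := ENNReal.tendsto_ofReal (hρ.const_mul 2)
      simpa using this)
    (fun N q => T (q.1 + N) q.2) (Eventually.of_forall fun N q => by
      refine (hT _ _).trans (ENNReal.ofReal_le_ofReal ?_)
      have h1 := hle (q.1 + N)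
      have h2 : (b ^ (q.1 + N))⁻¹ ≤ (b ^ N)⁻¹ := by
        gcongr
        · exact hb.le
        · omega
      linarith)
    (Eventually.of_forall fun N x hx => by
      obtain ⟨n, hn, p, hp⟩ := (frequently_atTop.1 (h x hx)) N
      refine mem_iUnion.2 ⟨(n - N, p), ?_⟩
      simp only [Nat.sub_add_cancel hn]
      exact ⟨hx, by rwa [mem_closedBall, Real.dist_eq]⟩)
  have hzero : Tendsto (fun N : ℕ => ∑' q : ℕ × ℤ, ediam (T (q.1 + N) q.2) ^ (d : ℝ)) atTop
      (𝓝 0) := by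
    refine tendsto_of_tendsto_of_tendsto_of_le_of_le' tendsto_const_nhds htail
      (Eventually.of_forall fun _ => zero_le) ?_
    obtain ⟨N₀, hN₀⟩ := eventually_atTop.1 hsum
    filter_upwards [eventually_ge_atTop N₀] with N hN
    rw [ENNReal.tsum_prod']
    refine ENNReal.tsum_le_tsum fun k => ?_
    exact hN₀ (k + N) (le_add_left hN)
  rw [hzero.liminf_eq] at hcov
  rw [nonpos_iff_eq_zero.1 hcov] at hd
  exact ENNReal.zero_ne_top hd

/-- Points which are `t⁻ⁿ`-adically approximable to order `τ` form, inside `A`, a set of Hausdorff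
dimension at most `dimP A / τ`. -/
lemma dimH_inter_le_dimP_div {b : ℝ} (hb : 1 < b) {τ : ℝ} (hτ : 1 ≤ τ) {E A : Set ℝ}
    (h : ∀ x ∈ E, ∃ᶠ n : ℕ in atTop, ∃ p : ℤ, |x - p / b ^ n| ≤ (b ^ n)⁻¹ ^ τ) :
    dimH (E ∩ A) ≤ ENNReal.ofReal τ⁻¹ * dimP A := by
  have hmain : ∀ s : ℝ≥0, packingMeasure s A = 0 → dimH (E ∩ A) ≤ ENNReal.ofReal τ⁻¹ * s := by
    intro s hs
    -- Any finite bound would do: it makes the pre-measure of each piece finite at some scale.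
    have h1 : packingMeasure s A < 1 := by rw [hs]; exact one_pos
    unfold packingMeasure at h1
    obtain ⟨U, hU⟩ := iInf_lt_iff.1 h1
    obtain ⟨hAU, hU⟩ := iInf_lt_iff.1 hU
    have hcover : E ∩ A ⊆ ⋃ i, E ∩ U i := by
      rw [← inter_iUnion]
      exact inter_subset_inter_right _ hAU
    refine (dimH_mono hcover).trans ?_
    rw [dimH_iUnion]
    refine iSup_le fun i => ?_
    have h2 : packingPre s (U i) < ∞ :=
      ((ENNReal.le_tsum i).trans_lt hU).trans ENNReal.one_lt_top
    unfold packingPre at h2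
    obtain ⟨δ, hδ⟩ := iInf_lt_iff.1 h2
    obtain ⟨hδ0, hδ⟩ := iInf_lt_iff.1 hδ
    have h3 : packingPreDelta s δ (E ∩ U i) ≤ packingPreDelta s δ (U i) := by
      unfold packingPreDelta
      refine iSup₂_le fun S hS => le_iSup₂_of_le S ⟨fun B hB => ?_, hS.2⟩ le_rfl
      exact ⟨(hS.1 B hB).1.2, (hS.1 B hB).2⟩
    refine (dimH_le_of_packingPreDelta hb hδ0 hτ (h3.trans_lt hδ).ne
      fun x hx => h x hx.1).trans (le_of_eq ?_)
    rw [div_eq_inv_mul, ENNReal.ofReal_mul (by positivity), ENNReal.ofReal_coe_nnreal]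
  have hτ0 : ENNReal.ofReal τ⁻¹ ≠ 0 := by
    rw [Ne, ENNReal.ofReal_eq_zero, not_le]
    positivity
  unfold dimP
  rw [ENNReal.mul_iInf_of_ne hτ0 ENNReal.ofReal_ne_top]
  refine le_iInf fun s => ?_
  rw [ENNReal.mul_iInf_of_ne hτ0 ENNReal.ofReal_ne_top]
  exact le_iInf fun hs => hmain s hs

/-! ### Spreading digits over a prescribed set of positions. -/

section Digits

variable (t : ℕ) (F : ℕ → Prop) [DecidablePred F]

/-- The integer formed by the first `m` digits in base `t` of the number obtained by writing the
digits of `y` at the positions satisfying `F`, and zeros at the others. -/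
noncomputable def spreadPrefix (y : ℝ) : ℕ → ℤ
  | 0 => 0
  | m + 1 => t * spreadPrefix y m +
      if F m then ⌊y * t ^ (Nat.count F m + 1)⌋ - t * ⌊y * t ^ Nat.count F m⌋ else 0

/-- The number whose digits in base `t` are those of `y` at the positions satisfying `F`, and zero
at the others. -/
noncomputable def spread (y : ℝ) : ℝ := ⨆ m, (spreadPrefix t F y m : ℝ) / t ^ m

lemma floor_mul_pow_succ_sub (t : ℕ) (ht : 2 ≤ t) (y : ℝ) (c : ℕ) :
    0 ≤ ⌊y * (t : ℝ) ^ (c + 1)⌋ - t * ⌊y * (t : ℝ) ^ c⌋ ∧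
      ⌊y * (t : ℝ) ^ (c + 1)⌋ - t * ⌊y * (t : ℝ) ^ c⌋ ≤ (t : ℤ) - 1 := by
  have ht0 : (0 : ℝ) < t := by positivity
  have h : y * (t : ℝ) ^ (c + 1) = t * (y * (t : ℝ) ^ c) := by ring
  rw [h]
  set z := y * (t : ℝ) ^ c
  have h1 := Int.floor_le z
  have h2 := Int.lt_floor_add_one z
  constructor
  · rw [sub_nonneg]
    apply Int.le_floor.2
    push_cast
    gcongr
  · have : ⌊(t : ℝ) * z⌋ < t * ⌊z⌋ + t := by
      apply Int.floor_lt.2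
      push_cast
      nlinarith
    linarith

variable {t F}

lemma spreadPrefix_succ_bounds (ht : 2 ≤ t) (y : ℝ) (m : ℕ) :
    t * spreadPrefix t F y m ≤ spreadPrefix t F y (m + 1) ∧
      spreadPrefix t F y (m + 1) ≤ t * spreadPrefix t F y m + (t - 1) := by
  rw [spreadPrefix]
  have h := floor_mul_pow_succ_sub t ht y (Nat.count F m)
  split_ifs
  · constructor <;> linarith
  · constructor
    · linarith
    · have : (2 : ℤ) ≤ t := by exact_mod_cast ht
      linarith

/-- Each appended digit lies between `0` and `t - 1`, so the prefix intervals are nested. -/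
lemma spread_mem_Icc (ht : 2 ≤ t) (y : ℝ) (m : ℕ) :
    spread t F y ∈ Icc ((spreadPrefix t F y m : ℝ) / t ^ m)
      ((spreadPrefix t F y m + 1 : ℝ) / t ^ m) := by
  have ht0 : (0 : ℝ) < t := by positivity
  have hmono : Monotone fun m => (spreadPrefix t F y m : ℝ) / t ^ m := by
    refine monotone_nat_of_le_succ fun m => ?_
    have h : (t : ℝ) * spreadPrefix t F y m ≤ spreadPrefix t F y (m + 1) := by
      exact_mod_cast (spreadPrefix_succ_bounds ht y m).1
    rw [div_le_div_iff₀ (by positivity) (by positivity), pow_succ]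
    nlinarith [pow_pos ht0 m]
  have hanti : Antitone fun m => (spreadPrefix t F y m + 1 : ℝ) / t ^ m := by
    refine antitone_nat_of_succ_le fun m => ?_
    have h : (spreadPrefix t F y (m + 1) : ℝ) ≤ t * spreadPrefix t F y m + (t - 1) := by
      exact_mod_cast (spreadPrefix_succ_bounds ht y m).2
    rw [div_le_div_iff₀ (by positivity) (by positivity), pow_succ]
    nlinarith [pow_pos ht0 m]
  have := hmono.ciSup_mem_iInter_Icc_of_antitone hanti fun m => by
    simp only
    gcongr
    linarith
  exact mem_iInter.1 this m

/-- At a free position both differences undergo the same map `u ↦ t * u + e` with `|e| ≤ t - 1`; at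
a blocked one only the prefix difference is multiplied by `t`. The induction also tracks signs: a
nonzero integer keeps its sign under such a map. -/
lemma abs_floor_sub_le_abs_spreadPrefix_sub (ht : 2 ≤ t) {y z : ℝ} (hy : y ∈ Ico (0 : ℝ) 1)
    (hz : z ∈ Ico (0 : ℝ) 1) (m : ℕ) :
    |⌊y * (t : ℝ) ^ Nat.count F m⌋ - ⌊z * (t : ℝ) ^ Nat.count F m⌋| ≤
      |spreadPrefix t F y m - spreadPrefix t F z m| := by
  have ht' : (2 : ℤ) ≤ t := by exact_mod_cast ht
  suffices H : ∀ m, ∃ D D' : ℤ,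
      ⌊y * (t : ℝ) ^ Nat.count F m⌋ - ⌊z * (t : ℝ) ^ Nat.count F m⌋ = D' ∧
      spreadPrefix t F y m - spreadPrefix t F z m = D ∧
      (D = 0 ∧ D' = 0 ∨ 1 ≤ D' ∧ D' ≤ D ∨ D ≤ D' ∧ D' ≤ -1) by
    obtain ⟨D, D', h1, h2, h3⟩ := H m
    rw [h1, h2]
    rcases h3 with h | h | h
    · simp [h.1, h.2]
    · rw [abs_of_nonneg (by omega), abs_of_nonneg (by omega)]; omega
    · rw [abs_of_nonpos (by omega), abs_of_nonpos (by omega)]; omega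
  intro m
  induction m with
  | zero =>
    have h1 : ⌊y⌋ = 0 := Int.floor_eq_zero_iff.2 hy
    have h2 : ⌊z⌋ = 0 := Int.floor_eq_zero_iff.2 hz
    exact ⟨0, 0, by simp [h1, h2], by simp [spreadPrefix], by simp⟩
  | succ m ih =>
    obtain ⟨D, D', h1, h2, h3⟩ := ih
    by_cases hF : F m
    · have hyd := floor_mul_pow_succ_sub t ht y (Nat.count F m)
      have hzd := floor_mul_pow_succ_sub t ht z (Nat.count F m)
      simp only [spreadPrefix, Nat.count_succ, hF, if_true]
      generalize ⌊y * (t : ℝ) ^ (Nat.count F m + 1)⌋ = y' at *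
      generalize ⌊z * (t : ℝ) ^ (Nat.count F m + 1)⌋ = z' at *
      generalize ⌊y * (t : ℝ) ^ Nat.count F m⌋ = y₀ at *
      generalize ⌊z * (t : ℝ) ^ Nat.count F m⌋ = z₀ at *
      refine ⟨t * D + ((y' - t * y₀) - (z' - t * z₀)), t * D' + ((y' - t * y₀) - (z' - t * z₀)),
        by rw [← h1]; ring, by rw [← h2]; ring, ?_⟩
      rcases h3 with ⟨h, h'⟩ | ⟨h, h'⟩ | ⟨h, h'⟩
      · subst h h'
        simp only [mul_zero, zero_add]
        omega
      · right; left
        constructor <;> nlinarith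
      · right; right
        constructor <;> nlinarith
    · simp only [spreadPrefix, Nat.count_succ, hF, if_false, add_zero]
      refine ⟨t * D, D', h1, by rw [← h2]; ring, ?_⟩
      rcases h3 with ⟨h, h'⟩ | ⟨h, h'⟩ | ⟨h, h'⟩
      · simp [h, h']
      · right; left
        exact ⟨h, by nlinarith⟩
      · right; right
        exact ⟨by nlinarith, h'⟩

/-- The `2` is one unit for replacing spread numbers by prefixes and one for the floors. -/
lemma abs_sub_mul_le_of_spread (ht : 2 ≤ t) {y z : ℝ} (hy : y ∈ Ico (0 : ℝ) 1)
    (hz : z ∈ Ico (0 : ℝ) 1) (m : ℕ) :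
    |y - z| * (t : ℝ) ^ Nat.count F m ≤ |spread t F y - spread t F z| * t ^ m + 2 := by
  have ht0 : (0 : ℝ) < t := by positivity
  have h : ((|⌊y * (t : ℝ) ^ Nat.count F m⌋ - ⌊z * (t : ℝ) ^ Nat.count F m⌋| : ℤ) : ℝ) ≤
      (|spreadPrefix t F y m - spreadPrefix t F z m| : ℤ) := by
    exact_mod_cast abs_floor_sub_le_abs_spreadPrefix_sub ht hy hz m
  push_cast at h
  obtain ⟨hy1, hy2⟩ := spread_mem_Icc (F := F) ht y m
  obtain ⟨hz1, hz2⟩ := spread_mem_Icc (F := F) ht z m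
  rw [div_le_iff₀ (by positivity)] at hy1 hz1
  rw [le_div_iff₀ (by positivity)] at hy2 hz2
  have h1 : |(spreadPrefix t F y m : ℝ) - spreadPrefix t F z m| ≤
      |spread t F y - spread t F z| * t ^ m + 1 := by
    have e : |spread t F y - spread t F z| * (t : ℝ) ^ m =
        |spread t F y * t ^ m - spread t F z * t ^ m| := by
      rw [← sub_mul, abs_mul, abs_of_pos (pow_pos ht0 m)]
    rw [e, abs_le]
    have := abs_le.1 (le_refl |spread t F y * t ^ m - spread t F z * t ^ m|)
    constructor <;> linarith
  have h2 : |y - z| * (t : ℝ) ^ Nat.count F m ≤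
      |(⌊y * (t : ℝ) ^ Nat.count F m⌋ : ℝ) - ⌊z * (t : ℝ) ^ Nat.count F m⌋| + 1 := by
    have e : |y - z| * (t : ℝ) ^ Nat.count F m =
        |y * (t : ℝ) ^ Nat.count F m - z * (t : ℝ) ^ Nat.count F m| := by
      rw [← sub_mul, abs_mul, abs_of_pos (pow_pos ht0 _)]
    rw [e]
    generalize y * (t : ℝ) ^ Nat.count F m = u
    generalize z * (t : ℝ) ^ Nat.count F m = v
    have a1 := Int.floor_le u
    have a2 := Int.lt_floor_add_one u
    have a3 := Int.floor_le v
    have a4 := Int.lt_floor_add_one v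
    have := abs_le.1 (le_refl |(⌊u⌋ : ℝ) - ⌊v⌋|)
    rw [abs_le]
    constructor <;> linarith
  linarith

lemma spreadPrefix_add_of_forall_not (y : ℝ) (n k : ℕ) (h : ∀ i, n ≤ i → i < n + k → ¬ F i) :
    spreadPrefix t F y (n + k) = t ^ k * spreadPrefix t F y n := by
  induction k with
  | zero => simp
  | succ k ih =>
    rw [← add_assoc, spreadPrefix, if_neg (h (n + k) (by omega) (by omega)),
      ih fun i hi hi' => h i hi (by omega)]
    ring

lemma abs_spread_sub_le (ht : 2 ≤ t) (y : ℝ) (n k : ℕ) (h : ∀ i, n ≤ i → i < n + k → ¬ F i) :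
    |spread t F y - spreadPrefix t F y n / t ^ n| ≤ ((t : ℝ) ^ (n + k))⁻¹ := by
  have ht0 : (0 : ℝ) < t := by positivity
  obtain ⟨h1, h2⟩ := spread_mem_Icc (F := F) ht y (n + k)
  have e : (spreadPrefix t F y (n + k) : ℝ) / t ^ (n + k) = spreadPrefix t F y n / t ^ n := by
    rw [spreadPrefix_add_of_forall_not y n k h]
    push_cast
    field_simp
    ring
  rw [add_div, e, one_div] at h2
  rw [e] at h1
  rw [abs_le]
  constructor
  · have : 0 < ((t : ℝ) ^ (n + k))⁻¹ := by positivity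
    linarith
  · linarith

/-- If the free positions have lower density at least `s`, then the image of `[0, 1)` under `spread`
has Hausdorff dimension at least `s`. -/
lemma le_dimH_image_spread (ht : 2 ≤ t) {s C : ℝ} (hs : 0 < s)
    (hF : ∀ m : ℕ, s * m - C ≤ Nat.count F m) :
    ENNReal.ofReal s ≤ dimH (spread t F '' Ico 0 1) := by
  have ht1 : (1 : ℝ) < t := by exact_mod_cast ht
  have ht0 : (0 : ℝ) < t := by positivity
  -- The `3` is `1 + 2` from `abs_sub_mul_le_of_spread`, `t ^ C` pays for the defect in `hF`, and `t
  -- ^ s` for passing from `m` to `m + 1`.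
  set K : ℝ := 3 * t ^ (C + s) with hK
  have hK0 : 0 < K := by positivity
  have hcount : ∀ m : ℕ, (t : ℝ) ^ (s * m - C) ≤ t ^ Nat.count F m := fun m => by
    rw [← Real.rpow_natCast _ (Nat.count F m)]
    exact Real.rpow_le_rpow_of_exponent_le ht1.le (hF m)
  have hmain : ∀ y ∈ Ico (0 : ℝ) 1, ∀ z ∈ Ico (0 : ℝ) 1,
      |y - z| ≤ K * |spread t F y - spread t F z| ^ s := by
    intro y hy z hz
    rcases (abs_nonneg (spread t F y - spread t F z)).eq_or_lt with h0 | hpos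
    · rw [← h0, Real.zero_rpow hs.ne', mul_zero]
      by_contra! hlt
      obtain ⟨m, hm⟩ : ∃ m : ℕ, 2 / |y - z| < t ^ (s * m - C) := by
        have hts : 1 < (t : ℝ) ^ s := Real.one_lt_rpow ht1 hs
        obtain ⟨m, hm⟩ := pow_unbounded_of_one_lt (2 / |y - z| * t ^ C) hts
        refine ⟨m, ?_⟩
        rw [Real.rpow_sub ht0, Real.rpow_mul ht0.le, Real.rpow_natCast, lt_div_iff₀ (by positivity)]
        exact hm
      have h1 := abs_sub_mul_le_of_spread (F := F) ht hy hz m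
      rw [← h0, zero_mul, zero_add] at h1
      have h2 := hm.trans_le (hcount m)
      rw [div_lt_iff₀ hlt] at h2
      linarith
    · have hle1 : |spread t F y - spread t F z| ≤ 1 := by
        obtain ⟨a1, a2⟩ := spread_mem_Icc (F := F) ht y 0
        obtain ⟨a3, a4⟩ := spread_mem_Icc (F := F) ht z 0
        simp only [spreadPrefix, Int.cast_zero, zero_add, pow_zero, div_one] at a1 a2 a3 a4
        rw [abs_le]
        constructor <;> linarith
      obtain ⟨m, hm1, hm2⟩ := exists_nat_pow_near_of_lt_one hpos hle1 (inv_pos.2 ht0)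
        (inv_lt_one_of_one_lt₀ ht1)
      have h1 := abs_sub_mul_le_of_spread (F := F) ht hy hz m
      have h2 : |spread t F y - spread t F z| * (t : ℝ) ^ m ≤ 1 := by
        rw [inv_pow] at hm2
        calc _ ≤ ((t : ℝ) ^ m)⁻¹ * t ^ m := by gcongr
          _ = 1 := inv_mul_cancel₀ (by positivity)
      have h3 : |y - z| * t ^ (s * m - C) ≤ 3 :=
        (mul_le_mul_of_nonneg_left (hcount m) (abs_nonneg _)).trans (by linarith)
      have h4 : (t : ℝ) ^ (-(s * (m + 1))) ≤ |spread t F y - spread t F z| ^ s := by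
        have : (t : ℝ) ^ (-(s * (m + 1))) = ((t : ℝ)⁻¹ ^ (m + 1)) ^ s := by
          rw [inv_pow, inv_pow_rpow ht0, Real.inv_rpow ht0.le, Real.rpow_neg ht0.le,
            inv_pow, ← Real.rpow_natCast, ← Real.rpow_mul ht0.le]
          push_cast
          rfl
        rw [this]
        exact Real.rpow_le_rpow (by positivity) hm1.le hs.le
      calc |y - z| = |y - z| * t ^ (s * m - C) * t ^ (-(s * m - C)) := by
            rw [mul_assoc, ← Real.rpow_add ht0]; simp
        _ ≤ 3 * t ^ (-(s * m - C)) := by gcongr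
        _ = K * t ^ (-(s * (m + 1))) := by
            rw [hK, mul_assoc, ← Real.rpow_add ht0]
            congr 2
            ring
        _ ≤ _ := by gcongr
  have hinj : InjOn (spread t F) (Ico 0 1) := by
    intro y hy z hz h
    have := hmain y hy z hz
    rw [h, sub_self, abs_zero, Real.zero_rpow hs.ne', mul_zero] at this
    exact sub_eq_zero.1 (abs_eq_zero.1 (le_antisymm this (abs_nonneg _)))
  -- The inverse of `spread` is `s`-Hölder and maps onto `[0, 1)`, which has dimension `1`.
  set f := Function.invFunOn (spread t F) (Ico 0 1) with hf
  have hleft : ∀ y ∈ Ico (0 : ℝ) 1, f (spread t F y) = y := fun y hy =>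
    hinj.leftInvOn_invFunOn hy
  have hholder : HolderOnWith K.toNNReal s.toNNReal f (spread t F '' Ico 0 1) := by
    rintro _ ⟨y, hy, rfl⟩ _ ⟨z, hz, rfl⟩
    rw [hleft y hy, hleft z hz, edist_dist, edist_dist, Real.dist_eq, Real.dist_eq,
      Real.coe_toNNReal s hs.le, ENNReal.ofReal_rpow_of_nonneg (abs_nonneg _) hs.le]
    change _ ≤ ENNReal.ofReal K * _
    rw [← ENNReal.ofReal_mul hK0.le]
    exact ENNReal.ofReal_le_ofReal (hmain y hy z hz)
  have himage : f '' (spread t F '' Ico 0 1) = Ico 0 1 := by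
    rw [image_image]
    exact (image_congr hleft).trans (image_id' _)
  have h1 := hholder.dimH_image_le (Real.toNNReal_pos.2 hs)
  rw [himage, Real.dimH_of_nonempty_interior (by simp)] at h1
  rw [Module.finrank_self, Nat.cast_one, ENNReal.le_div_iff_mul_le (Or.inl (by simpa using hs))
    (Or.inl (by simp)), one_mul] at h1
  exact h1

end Digits

/-! ### Lower bound: blocks of zeros. -/

lemma exists_frequently_sparse {p : ℕ → Prop} (hp : ∃ᶠ n in atTop, p n) (h : ℕ → ℕ) :
    ∃ a : ℕ → ℕ, ∀ k, p (a k) ∧ 1 ≤ a k ∧ h (a k) ≤ a (k + 1) := by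
  have hpick : ∀ N, ∃ n, N ≤ n ∧ p n ∧ 1 ≤ n := fun N => by
    obtain ⟨n, hn, hpn⟩ := frequently_atTop.1 hp (N + 1)
    exact ⟨n, by omega, hpn, by omega⟩
  choose pick hle hpk h1 using hpick
  let a : ℕ → ℕ := fun k => Nat.rec (pick 0) (fun _ n => pick (h n)) k
  refine ⟨a, fun k => ⟨?_, ?_, hle (h (a k))⟩⟩
  · cases k
    · exact hpk _
    · exact hpk _
  · cases k
    · exact h1 _
    · exact h1 _

lemma ofReal_inv_le_dimH_wellApprox {t : ℕ} (ht : 2 ≤ t) {ψ : ℕ → ℝ} {τ : ℝ} (hτ : 1 ≤ τ)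
    (hψ : ∃ᶠ n : ℕ in atTop, ((t : ℝ) ^ n)⁻¹ ^ τ ≤ ψ n) :
    ENNReal.ofReal τ⁻¹ ≤ dimH (wellApprox t ψ) := by
  classical
  have ht1 : (1 : ℝ) < t := by exact_mod_cast ht
  have ht0 : (0 : ℝ) < t := by positivity
  have hτ0 : 0 < τ := by linarith
  suffices H : ∀ s : ℝ, 0 < s → s < τ⁻¹ → ENNReal.ofReal s ≤ dimH (wellApprox t ψ) by
    have hlim : Tendsto ENNReal.ofReal (𝓝[<] τ⁻¹) (𝓝 (ENNReal.ofReal τ⁻¹)) :=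
      ENNReal.continuous_ofReal.continuousAt.tendsto.mono_left nhdsWithin_le_nhds
    refine le_of_tendsto hlim ?_
    filter_upwards [Ioo_mem_nhdsLT (inv_pos.2 hτ0)] with s hs
    exact H s hs.1 hs.2
  intro s hs hsτ
  have hsτ1 : s * τ < 1 := by
    rwa [lt_inv_comm₀ hs hτ0, ← one_div, lt_div_iff₀ hs, mul_comm] at hsτ
  -- Earlier blocks will use at most a proportion `1 / L ≤ 1 - s * τ` of the positions below `a k`.
  obtain ⟨L, hL⟩ := exists_nat_gt (1 - s * τ)⁻¹
  have hL0 : (0 : ℝ) < L := (inv_pos.2 (by linarith)).trans hL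
  have hL1 : 1 ≤ L := by exact_mod_cast hL0
  have hL2 : 1 ≤ L * (1 - s * τ) := by
    rw [inv_lt_iff_one_lt_mul₀ (by linarith)] at hL
    exact hL.le
  -- The least integer above `τ * n`; strictness matters because `ψ n` may equal `t ^ (-n τ)`.
  set M : ℕ → ℕ := fun n => ⌊τ * n⌋₊ + 1 with hM
  have hM1 : ∀ n, n < M n := fun n => by
    have : n ≤ ⌊τ * n⌋₊ := Nat.le_floor (by nlinarith [(Nat.cast_nonneg n : (0 : ℝ) ≤ n)])
    simp only [hM]; omega
  have hM2 : ∀ n : ℕ, (M n : ℝ) ≤ τ * n + 1 := fun n => by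
    simp only [hM]
    push_cast
    linarith [Nat.floor_le (show 0 ≤ τ * n by positivity)]
  have hM3 : ∀ n : ℕ, ((t : ℝ) ^ M n)⁻¹ < ((t : ℝ) ^ n)⁻¹ ^ τ := fun n => by
    rw [Real.inv_rpow (by positivity)]
    refine inv_strictAnti₀ (by positivity) ?_
    rw [← Real.rpow_natCast, ← Real.rpow_mul ht0.le, ← Real.rpow_natCast]
    refine Real.rpow_lt_rpow_of_exponent_lt ht1 ?_
    simp only [hM]
    push_cast
    linarith [Nat.lt_floor_add_one (τ * n)]
  have hMmono : Monotone M := fun m n hmn => by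
    simp only [hM]
    gcongr
  obtain ⟨a, ha⟩ := exists_frequently_sparse hψ fun n => L * M n
  have hastep : ∀ k, M (a k) ≤ a (k + 1) := fun k =>
    (Nat.le_mul_of_pos_left _ hL1).trans (ha k).2.2
  have hamono : StrictMono a := strictMono_nat_of_lt_succ fun k => (hM1 _).trans_le (hastep k)
  let F : ℕ → Prop := fun i => ∀ k, ¬ (a k ≤ i ∧ i < M (a k))
  have hfree : ∀ k, ∃ N, L * N ≤ a k ∧ ∀ i, N ≤ i → i < a k → F i := by
    rintro (_ | k)
    · exact ⟨0, by simp, fun i _ hi j hj =>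
        absurd (hamono.monotone (Nat.zero_le j)) (by omega)⟩
    · refine ⟨M (a k), (ha k).2.2, fun i hi hi' j hj => ?_⟩
      rcases le_or_gt j k with h | h
      · have := hMmono (hamono.monotone h)
        omega
      · have := hamono.monotone (Nat.succ_le_of_lt h)
        simp only [Nat.succ_eq_add_one] at this
        omega
  have hcount : ∀ k, L * a k ≤ L * Nat.count F (a k) + a k := by
    intro k
    obtain ⟨N, hN, hNF⟩ := hfree k
    have hNa : N ≤ a k := (Nat.le_mul_of_pos_left _ hL1).trans hN
    have h1 : a k - N ≤ Nat.count F (a k) := by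
      conv_rhs => rw [← Nat.add_sub_cancel' hNa, Nat.count_add]
      rw [Nat.count_of_forall (p := fun i => F (N + i)) fun i hi =>
        hNF (N + i) (by omega) (by omega)]
      omega
    have h2 : L * a k ≤ L * (Nat.count F (a k) + N) := Nat.mul_le_mul_left _ (by omega)
    rw [mul_add] at h2
    omega
  -- A free position adds `1 ≥ s`. Inside a block, `Nat.count F (a k) ≥ (1 - 1 / L) * a k ≥ s * τ *
  -- a k`, and the `- s` absorbs the rounding in `M`.
  have hdens : ∀ m : ℕ, s * m - s ≤ Nat.count F m := by
    intro m
    have hs1 : s ≤ 1 := by nlinarith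
    induction m with
    | zero => simp [hs.le]
    | succ m ih =>
      by_cases hFm : F m
      · rw [Nat.count_succ, if_pos hFm]
        push_cast
        linarith
      · simp only [F, not_forall, not_not] at hFm
        obtain ⟨k, hk1, hk2⟩ := hFm
        have h1 : (Nat.count F (a k) : ℝ) ≤ Nat.count F (m + 1) := by
          exact_mod_cast Nat.count_monotone F (by omega)
        have h2 : (L : ℝ) * a k ≤ L * Nat.count F (a k) + a k := by exact_mod_cast hcount k
        have h3 : ((m + 1 : ℕ) : ℝ) ≤ τ * a k + 1 :=
          (show ((m + 1 : ℕ) : ℝ) ≤ M (a k) by exact_mod_cast hk2).trans (hM2 _)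
        have h4 : s * ((m + 1 : ℕ) : ℝ) ≤ s * (τ * a k + 1) := by gcongr
        have h5 : (a k : ℝ) * 1 ≤ a k * (L * (1 - s * τ)) := by gcongr
        have h6 : (L : ℝ) * (s * τ * a k) ≤ L * Nat.count F (a k) := by linarith
        have h7 := le_of_mul_le_mul_left h6 hL0
        linarith
  refine (le_dimH_image_spread (F := F) ht hs hdens).trans (dimH_mono ?_)
  rintro _ ⟨y, -, rfl⟩
  refine ⟨by simpa [spreadPrefix] using spread_mem_Icc (F := F) ht y 0, ?_⟩
  refine infinite_of_injective_forall_mem (f := fun k => (spreadPrefix t F y (a k), a k))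
    (fun i j h => hamono.injective (congrArg Prod.snd h)) fun k => ⟨(ha k).2.1, ?_⟩
  have hle := (hM1 (a k)).le
  have h1 := abs_spread_sub_le (F := F) ht y (a k) (M (a k) - a k) fun i hi hi' h =>
    h k ⟨hi, by omega⟩
  rw [Nat.add_sub_cancel' hle] at h1
  exact h1.trans_lt ((hM3 _).trans_le (ha k).1)

/-! ### Combining the bounds. -/

/-- Each `n` admits only finitely many `p`, so infinitely many pairs involve infinitely many `n`. -/
lemma frequently_of_mem_wellApprox {t : ℕ} (ht : 2 ≤ t) {ψ : ℕ → ℝ} {x : ℝ}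
    (hx : x ∈ wellApprox t ψ) :
    ∃ᶠ n : ℕ in atTop, ∃ p : ℤ, |x - p / (t : ℝ) ^ n| < ψ n := by
  have ht0 : (0 : ℝ) < t := by positivity
  intro hev
  obtain ⟨N, hN⟩ := eventually_atTop.1 hev
  refine hx.2 (Finite.subset (s := ⋃ n ∈ Iio N,
    Icc ⌊(x - ψ n) * t ^ n⌋ ⌈(x + ψ n) * t ^ n⌉ ×ˢ {n}) ?_ ?_)
  · exact (finite_Iio N).biUnion fun n _ => (finite_Icc _ _).prod (finite_singleton n)
  · rintro ⟨p, n⟩ ⟨-, hp⟩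
    simp only at hp
    have hn : n < N := by
      by_contra! h
      exact hN n h ⟨p, hp⟩
    refine mem_biUnion (mem_Iio.2 hn) ⟨?_, rfl⟩
    have hp' := abs_lt.1 hp
    have e : (p : ℝ) = p / (t : ℝ) ^ n * t ^ n := by field_simp
    constructor
    · have : (x - ψ n) * (t : ℝ) ^ n ≤ p := by
        rw [e]; gcongr; linarith
      exact_mod_cast (Int.floor_le _).trans this
    · have : (p : ℝ) ≤ (x + ψ n) * (t : ℝ) ^ n := by
        rw [e]; gcongr; linarith
      exact_mod_cast this.trans (Int.le_ceil _)

/-- This is the case `τ = 1`, where rounding down makes every real approximable. -/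
lemma dimH_le_dimP (A : Set ℝ) : dimH A ≤ dimP A := by
  have h := dimH_inter_le_dimP_div (b := 2) one_lt_two le_rfl (E := univ) (A := A) fun x _ =>
    Frequently.of_forall fun n => ⟨⌊x * 2 ^ n⌋, by
      have h1 := Int.floor_le (x * 2 ^ n)
      have h2 := Int.lt_floor_add_one (x * 2 ^ n)
      have e : x - ⌊x * 2 ^ n⌋ / 2 ^ n = (x * 2 ^ n - ⌊x * 2 ^ n⌋) * ((2 : ℝ) ^ n)⁻¹ := by
        field_simp
      rw [e, Real.rpow_one, abs_mul, abs_of_nonneg (by linarith), abs_of_pos (by positivity)]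
      exact mul_le_of_le_one_left (by positivity) (by linarith)⟩
  simpa using h

end WellApprox

open WellApprox Filter Topology in
theorem corollary17 (t : ℕ) (ht : 2 ≤ t) (ψ : ℕ → ℝ) (hψ : ∀ n : ℕ, 1 ≤ n → 0 < ψ n)
    (A : Set ℝ) (hA : A.Nonempty) (hA01 : A ⊆ Set.Icc (0 : ℝ) 1) :
    dimH (WellApprox.wellApprox t ψ ∩ A) ≤
      dimH (WellApprox.wellApprox t ψ) * WellApprox.dimP A := by
  set d := dimH (wellApprox t ψ) with hd
  have hdtop : d ≠ ⊤ := Real.dimH_ne_top _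
  rcases le_or_gt 1 d with h1 | h1
  · calc dimH (wellApprox t ψ ∩ A) ≤ dimH A := dimH_mono Set.inter_subset_right
      _ ≤ 1 * dimP A := by rw [one_mul]; exact dimH_le_dimP A
      _ ≤ d * dimP A := by gcongr
  rcases eq_or_ne d 0 with h0 | h0
  · exact (dimH_mono Set.inter_subset_left).trans (by rw [← hd, h0]; exact zero_le)
  have hmain : ∀ q, d < q → q < 1 → dimH (wellApprox t ψ ∩ A) ≤ q * dimP A := by
    intro q hdq hq1
    have hqtop : q ≠ ⊤ := (hq1.trans ENNReal.one_lt_top).ne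
    have hq0 : 0 < q.toReal := ENNReal.toReal_pos (bot_le.trans_lt hdq).ne' hqtop
    have hτ : 1 ≤ q.toReal⁻¹ := (one_le_inv₀ hq0).2 (ENNReal.toReal_mono (by simp) hq1.le)
    have hev : ∀ᶠ n : ℕ in atTop, ψ n < ((t : ℝ) ^ n)⁻¹ ^ q.toReal⁻¹ := by
      by_contra hcon
      have := ofReal_inv_le_dimH_wellApprox ht hτ (ψ := ψ) 
        ((not_eventually.1 hcon).mono fun n h => not_lt.1 h)
      rw [inv_inv, ENNReal.ofReal_toReal hqtop] at this
      exact absurd this (not_le.2 hdq)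
    have := dimH_inter_le_dimP_div (b := t) (by exact_mod_cast ht) hτ (E := wellApprox t ψ)
      (A := A) fun x hx => ((frequently_of_mem_wellApprox ht hx).and_eventually hev).mono
        fun n ⟨⟨p, hp⟩, hn⟩ => ⟨p, (hp.trans hn).le⟩
    rwa [inv_inv, ENNReal.ofReal_toReal hqtop] at this
  -- With `d ≠ 0`, the product is continuous at `d` whether or not `dimP A` is finite.
  have hlim : Tendsto (fun q => q * dimP A) (𝓝[>] d) (𝓝 (d * dimP A)) :=
    (ENNReal.Tendsto.mul_const tendsto_id (Or.inl h0)).mono_left nhdsWithin_le_nhds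
  have : (𝓝[>] d).NeBot := nhdsGT_neBot_of_exists_gt ⟨1, h1⟩
  refine ge_of_tendsto hlim ?_
  filter_upwards [Ioo_mem_nhdsGT h1] with q hq
  exact hmain q hq.1 hq.2
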